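/- Let $R$ be a (commutative) Dedekind domain that is not a field, and let $M$ be an $R$-module. A subset $X \subseteq M$ is a weak basis of $M$ if it generates $M$ and is weakly independent, that is, $x \notin \operatorname{Span}(X \setminus \{x\})$ for every $x \in X$ (equivalently, $X$ is a generating set of $M$ that is minimal with respect to inclusion). Call $M$ regularly weakly based if every generating set of $M$ contains a weak basis of $M$; call an $R$-module $B$ torsion if every element of $B$ has a non-zero annihilator, and bounded if $IB = 0$ for some non-zero ideal $I$ of $R$. If $M$ is regularly weakly based, then $M = P \oplus B$ for some submodules $P, B \subseteq M$ such that $P$ is finitely generated and projective and $B$ is a bounded torsion module. -/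

import Mathlib

section WeaklyBased

variable (R : Type*) {M : Type*} [CommRing R] [AddCommGroup M] [Module R M]

/-- A subset `X` of a module is weakly independent if no `x ∈ X` lies in the span of the other
elements of `X`. -/
def WeaklyIndependent (X : Set M) : Prop :=
  ∀ x ∈ X, x ∉ Submodule.span R (X \ {x})

/-- A weak basis is a weakly independent generating set. -/
def IsWeakBasis (X : Set M) : Prop :=
  WeaklyIndependent R X ∧ Submodule.span R X = ⊤

variable (M) in
/-- A module is regularly weakly based if each of its generating sets contains a weak basis. -/
def RegularlyWeaklyBased : Prop :=
  ∀ X : Set M, Submodule.span R X = ⊤ → ∃ Y ⊆ X, IsWeakBasis R Y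

variable (M) in
/-- A module `M` is bounded if `I M = 0` for some non-zero ideal `I`. -/
def IsBoundedModule : Prop :=
  ∃ I : Ideal R, I ≠ ⊥ ∧ I • (⊤ : Submodule R M) = ⊥

end WeaklyBased

open Submodule IsDedekindDomain

/-! Let `K` be the fraction field and, for a maximal ideal `p`, let `E` be the `p`-primary part of
`K / R`: it is divisible, hence injective, and it cogenerates `p`-primary modules. The heart of the
proof is that every homomorphism from `M` to `E` is killed by a power of `p`
(`RegularlyWeaklyBased.exists_pow_smul_eq_zero`). An unbounded image would equal `p` times itself.
The kernel would then surject onto `M / pM`, and lifting a basis of `M / pM` into the kernel would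
give a regularly weakly based quotient `Q = pQ`. Such a `Q` vanishes locally at `p`, because
divisible submodules are zero, and this forces the homomorphism to be zero.

By injectivity of `E`, boundedness excludes infinite independent families and bounds each primary
part of `M`. A chain argument leaves only finitely many nonzero primary parts when `M` is torsion,
so torsion modules are bounded. In general a maximal independent set spans a finite free `F` with `r
M ≤ F` for some `r ≠ 0`; the image of multiplication by `r` is projective, so its kernel splits off.
-/

/-! ### Quotients and chains -/

/-- Each class modulo `span R k` has a representative in `I M`. With such lifts, no element of `k`
can be dropped from a generating set, so a weak basis extracted upstairs contains `k` and its other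
elements stay irredundant modulo `k`. -/
theorem RegularlyWeaklyBased.quotient_span {R M : Type*} [CommRing R] [AddCommGroup M] [Module R M]
    (hM : RegularlyWeaklyBased R M) (I : Ideal R) (k : Set M)
    (hk : ∀ x ∈ k, x ∉ span R (k \ {x}) ⊔ I • (⊤ : Submodule R M))
    (hsup : span R k ⊔ I • (⊤ : Submodule R M) = ⊤) :
    RegularlyWeaklyBased R (M ⧸ span R k) := by
  intro Z hZ
  have hg : ∀ z : M ⧸ span R k, ∃ x ∈ I • (⊤ : Submodule R M), (span R k).mkQ x = z := by
    intro z
    obtain ⟨m, rfl⟩ := (span R k).mkQ_surjective z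
    obtain ⟨a, ha, b, hb, rfl⟩ := Submodule.mem_sup.1 (hsup.ge (mem_top (x := m)))
    refine ⟨b, hb, ?_⟩
    have : (span R k).mkQ a = 0 := by simpa using ha
    rw [map_add, this, zero_add]
  choose g hgI hg using hg
  have hgk : ∀ z, g z ∉ k := fun z hz => hk _ hz (mem_sup_right (hgI z))
  obtain ⟨Y, hYX, hYi, hYs⟩ := hM (k ∪ g '' Z) <| by
    rw [eq_top_iff]
    have h1 : map (span R k).mkQ (span R (k ∪ g '' Z)) = ⊤ := by
      rw [eq_top_iff, ← hZ, span_le]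
      intro z hz
      exact ⟨g z, subset_span (Or.inr ⟨z, hz, rfl⟩), hg z⟩
    rw [Submodule.map_mkQ_eq_top] at h1
    rw [← h1]
    exact sup_le (span_mono Set.subset_union_left) le_rfl
  have hkY : k ⊆ Y := by
    intro x hx
    by_contra hxY
    refine hk x hx ?_
    have : span R Y ≤ span R (k \ {x}) ⊔ I • (⊤ : Submodule R M) := by
      rw [span_le]
      intro y hy
      rcases hYX hy with h | ⟨z, hz, rfl⟩
      · exact mem_sup_left (subset_span ⟨h, fun h' => hxY (by rwa [← Set.mem_singleton_iff.1 h'])⟩)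
      · exact mem_sup_right (hgI z)
    exact this (hYs ▸ mem_top)
  refine ⟨{z ∈ Z | g z ∈ Y}, fun z hz => hz.1, ?_, ?_⟩
  · intro z hz hzs
    refine hYi (g z) hz.2 ?_
    have h2 : span R ({z ∈ Z | g z ∈ Y} \ {z}) ≤ map (span R k).mkQ (span R (Y \ {g z})) := by
      rw [span_le]
      intro w hw
      refine ⟨g w, subset_span ⟨hw.1.2, fun h => hw.2 ?_⟩, hg w⟩
      rw [Set.mem_singleton_iff] at h ⊢
      rw [← hg w, h, hg]
    obtain ⟨w, hw, hwz⟩ := h2 hzs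
    have h3 : g z - w ∈ span R k := by
      rw [← Submodule.ker_mkQ (span R k), LinearMap.mem_ker, map_sub, hg, hwz, sub_self]
    have h4 : span R k ≤ span R (Y \ {g z}) :=
      span_mono fun x hx => ⟨hkY hx, fun h => hgk z (by rwa [← Set.mem_singleton_iff.1 h])⟩
    have := add_mem (h4 h3) hw
    rwa [sub_add_cancel] at this
  · rw [eq_top_iff]
    rintro z -
    obtain ⟨m, rfl⟩ := (span R k).mkQ_surjective z
    have : span R Y ≤ comap (span R k).mkQ (span R {z ∈ Z | g z ∈ Y}) := by
      rw [span_le]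
      intro y hy
      rcases hYX hy with h | ⟨z, hz, rfl⟩
      · have : (span R k).mkQ y = 0 := by simpa using subset_span h
        simp [this]
      · rw [SetLike.mem_coe, mem_comap, hg]
        exact subset_span ⟨hz, hy⟩
    exact this (hYs ▸ mem_top)

/-- Finitely many elements `Y₀` of an extracted weak basis already span `L`. Those outside `Y₀` stay
irredundant in the quotient, and the finitely many images from `Y₀` can be thinned to a minimal
choice. -/
theorem RegularlyWeaklyBased.quotient_of_fg {R M : Type*} [CommRing R] [AddCommGroup M] [Module R M]
    (hM : RegularlyWeaklyBased R M) {L : Submodule R M} (hL : L.FG) :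
    RegularlyWeaklyBased R (M ⧸ L) := by
  intro Z hZ
  choose g hg using L.mkQ_surjective
  obtain ⟨k, hk⟩ := hL
  obtain ⟨Y, hYX, hYi, hYs⟩ := hM (k ∪ g '' Z) <| by
    rw [eq_top_iff]
    have h1 : map L.mkQ (span R (k ∪ g '' Z)) = ⊤ := by
      rw [eq_top_iff, ← hZ, span_le]
      intro z hz
      exact ⟨g z, subset_span (Or.inr ⟨z, hz, rfl⟩), hg z⟩
    rw [Submodule.map_mkQ_eq_top] at h1
    rw [← h1]
    exact sup_le (hk.ge.trans (span_mono Set.subset_union_left)) le_rfl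
  obtain ⟨Y₀, hY₀Y, hY₀⟩ : ∃ Y₀ : Finset M, (Y₀ : Set M) ⊆ Y ∧ L ≤ span R (Y₀ : Set M) := by
    have h : ∀ x : M, ∃ T : Finset M, (T : Set M) ⊆ Y ∧ x ∈ span R (T : Set M) := fun x =>
      mem_span_finite_of_mem_span (hYs ▸ mem_top)
    choose T hTY hT using h
    classical
    refine ⟨k.biUnion T, by simpa using fun i _ => hTY i, hk.ge.trans (span_le.2 fun x hx => ?_)⟩
    exact span_mono (by exact_mod_cast Finset.subset_biUnion_of_mem T hx) (hT x)
  have hginj : Function.Injective g := fun a b h => by rw [← hg a, h, hg]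
  let W₀ : Set (M ⧸ L) := {z ∈ Z | g z ∈ Y₀}
  let W₁ : Set (M ⧸ L) := {z ∈ Z | g z ∈ Y ∧ g z ∉ Y₀}
  have hW₀ : W₀.Finite := by
    refine Set.Finite.of_finite_image (f := g) (Y₀.finite_toSet.subset ?_) hginj.injOn
    rintro _ ⟨z, hz, rfl⟩
    exact hz.2
  have htop : span R (W₀ ∪ W₁) = ⊤ := by
    rw [eq_top_iff]
    rintro z -
    obtain ⟨m, rfl⟩ := L.mkQ_surjective z
    have : span R Y ≤ comap L.mkQ (span R (W₀ ∪ W₁)) := by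
      rw [span_le]
      intro y hy
      rcases hYX hy with h | ⟨z, hz, rfl⟩
      · have : L.mkQ y = 0 := by simpa [← hk] using subset_span h
        simp [this]
      · rw [SetLike.mem_coe, mem_comap, hg]
        refine subset_span ?_
        by_cases h : g z ∈ Y₀
        · exact Or.inl ⟨hz, h⟩
        · exact Or.inr ⟨hz, hy, h⟩
    exact this (hYs ▸ mem_top)
  have hfin : {A | A ⊆ W₀ ∧ span R (A ∪ W₁) = ⊤}.Finite :=
    hW₀.finite_subsets.subset fun A hA => hA.1
  obtain ⟨A, hAW, hA⟩ := hfin.exists_le_minimal (a := W₀) ⟨subset_rfl, htop⟩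
  have hAY : ∀ z ∈ A ∪ W₁, g z ∈ Y := by
    rintro z (hz | hz)
    · exact hY₀Y (hAW hz).2
    · exact hz.2.1
  refine ⟨A ∪ W₁, ?_, ?_, hA.prop.2⟩
  · rintro z (hz | hz)
    exacts [(hAW hz).1, hz.1]
  rintro z (hz | hz) hzs
  · have hsub : span R ((A \ {z}) ∪ W₁) = ⊤ := by
      have hz₁ : (A ∪ W₁) \ {z} ⊆ (A \ {z}) ∪ W₁ := by
        rintro w ⟨hw | hw, hwz⟩
        exacts [Or.inl ⟨hw, hwz⟩, Or.inr hw]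
      rw [eq_top_iff, ← hA.prop.2, span_le]
      rintro w hw
      by_cases hwz : w = z
      · rw [hwz]; exact span_mono hz₁ hzs
      · exact subset_span (hz₁ ⟨hw, hwz⟩)
    have := hA.le_of_le (y := A \ {z}) ⟨Set.sdiff_subset.trans hAW, hsub⟩ Set.sdiff_subset hz
    exact this.2 rfl
  · refine hYi (g z) hz.2.1 ?_
    have h2 : span R ((A ∪ W₁) \ {z}) ≤ map L.mkQ (span R (Y \ {g z})) := by
      rw [span_le]
      intro w hw
      exact ⟨g w, subset_span ⟨hAY w hw.1, fun h => hw.2 (hginj h)⟩, hg w⟩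
    obtain ⟨w, hw, hwz⟩ := h2 hzs
    have h3 : g z - w ∈ L := by
      rw [← Submodule.ker_mkQ L, LinearMap.mem_ker, map_sub, hg, hwz, sub_self]
    have h4 : span R (Y₀ : Set M) ≤ span R (Y \ {g z}) :=
      span_mono fun x hx => ⟨hY₀Y hx, fun h => hz.2.2 (by rwa [← Set.mem_singleton_iff.1 h])⟩
    have := add_mem (h4 (hY₀ h3)) hw
    rwa [sub_add_cancel] at this

/-- Of two distinct members of the chain, the earlier is a multiple of the later, so a weak basis
inside `N ∪ Set.range c` contains at most one of them. -/
theorem RegularlyWeaklyBased.exists_sup_span_singleton_eq_top {R M : Type*} [CommRing R]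
    [AddCommGroup M] [Module R M] (hM : RegularlyWeaklyBased R M) (N : Submodule R M) (c : ℕ → M)
    (hc : ∀ n, c n ∈ span R {c (n + 1)}) (hN : N ⊔ span R (Set.range c) = ⊤) :
    ∃ n, N ⊔ span R {c n} = ⊤ := by
  have hmono : Monotone fun n => span R {c n} :=
    monotone_nat_of_le_succ fun n => by simpa using hc n
  obtain ⟨Y, hYX, hYi, hYs⟩ := hM (N ∪ Set.range c) (by rw [span_union, span_eq, hN])
  have key : ∀ i j, i < j → c i ∈ Y → c j ∈ Y → c i = c j := by
    intro i j hij hi hj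
    by_contra hne
    refine hYi _ hi (span_mono (s := {c j}) ?_ (hmono hij.le (mem_span_singleton_self _)))
    simpa using ⟨hj, fun h => hne h.symm⟩
  have hall : ∀ i j, c i ∈ Y → c j ∈ Y → c i = c j := by
    intro i j hi hj
    rcases lt_trichotomy i j with h | h | h
    · exact key i j h hi hj
    · rw [h]
    · exact (key j i h hj hi).symm
  by_cases h : ∃ n, c n ∈ Y
  · obtain ⟨n, hn⟩ := h
    refine ⟨n, ?_⟩
    rw [eq_top_iff, ← hYs, span_le]
    intro y hy
    rcases hYX hy with h | ⟨m, rfl⟩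
    · exact mem_sup_left h
    · rw [hall m n hy hn]
      exact mem_sup_right (mem_span_singleton_self _)
  · refine ⟨0, ?_⟩
    rw [eq_top_iff, ← hYs, span_le]
    intro y hy
    rcases hYX hy with h' | ⟨m, rfl⟩
    · exact mem_sup_left h'
    · exact (h ⟨m, hy⟩).elim

/-- A divisible submodule is superfluous. -/
theorem RegularlyWeaklyBased.eq_top_of_sup_divisible {R M : Type*} [CommRing R] [IsDomain R]
    (hR : ¬ IsField R) [AddCommGroup M] [Module R M] (hM : RegularlyWeaklyBased R M)
    {C D : Submodule R M} (hD : ∀ r : R, r ≠ 0 → ∀ x ∈ D, ∃ y ∈ D, r • y = x) (hCD : C ⊔ D = ⊤) :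
    C = ⊤ := by
  obtain ⟨Y, hYX, hYi, hYs⟩ := hM (C ∪ D) (by rw [span_union, span_eq, span_eq, hCD])
  by_cases hYC : Y ⊆ C
  · rw [eq_top_iff, ← hYs]
    exact span_le.2 hYC
  exfalso
  obtain ⟨y, hy, hyC⟩ := Set.not_subset.1 hYC
  have hyD : y ∈ D := (hYX hy).resolve_left hyC
  have hdec : ∀ m : M, ∃ h ∈ span R (Y \ {y}), ∃ t : R, m = h + t • y := by
    intro m
    have : m ∈ span R (insert y (Y \ {y})) := by
      rw [Set.insert_sdiff_self_of_mem hy, hYs]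
      trivial
    obtain ⟨t, h, hh, rfl⟩ := mem_span_insert.1 this
    exact ⟨h, hh, t, add_comm _ _⟩
  -- Dividing `y` by a nonunit `s` puts `(1 - s * t) • y` in the span of the others, with `1 - s * t
  -- ≠ 0`. Dividing `y` by this scalar in turn puts `y` itself there.
  obtain ⟨s, hs0, hsu⟩ := Ring.exists_not_isUnit_of_not_isField hR
  obtain ⟨d, -, hd⟩ := hD s hs0 y hyD
  obtain ⟨h, hh, t, rfl⟩ := hdec d
  have hu : (1 - s * t) • y ∈ span R (Y \ {y}) := by
    have : (1 - s * t) • y = s • h := by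
      rw [sub_smul, one_smul, mul_smul, sub_eq_iff_eq_add, ← smul_add, hd]
    rw [this]
    exact smul_mem _ _ hh
  have hu0 : 1 - s * t ≠ 0 := fun h0 =>
    hsu (IsUnit.of_mul_eq_one t (sub_eq_zero.1 h0).symm)
  obtain ⟨d', -, hd'⟩ := hD _ hu0 y hyD
  obtain ⟨h', hh', t', rfl⟩ := hdec d'
  refine hYi y hy ?_
  rw [smul_add, smul_comm _ t'] at hd'
  have hmem := add_mem (smul_mem _ (1 - s * t) hh') (smul_mem _ t' hu)
  rwa [hd'] at hmem

/-! ### Primary parts -/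

/-- The submodule of elements killed by a power of the ideal `p`. -/
def primaryPart {R : Type*} [CommRing R] (p : Ideal R) (M : Type*) [AddCommGroup M] [Module R M] :
    Submodule R M where
  carrier := {x | ∃ n : ℕ, ∀ a ∈ p ^ n, a • x = 0}
  zero_mem' := ⟨0, fun _ _ => smul_zero _⟩
  add_mem' := by
    rintro x y ⟨m, hm⟩ ⟨n, hn⟩
    refine ⟨m + n, fun a ha => ?_⟩
    rw [smul_add, hm a (Ideal.pow_le_pow_right (by omega) ha),
      hn a (Ideal.pow_le_pow_right (by omega) ha), add_zero]
  smul_mem' := by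
    rintro c x ⟨n, hn⟩
    exact ⟨n, fun a ha => by rw [smul_comm, hn a ha, smul_zero]⟩

theorem exists_one_sub_mul_mem_pow {R : Type*} [CommRing R] {p : Ideal R} (hp : p.IsMaximal)
    {u : R} (hu : u ∉ p) (n : ℕ) : ∃ v, 1 - v * u ∈ p ^ n := by
  have h : IsCoprime (Ideal.span {u}) p := by
    rw [Ideal.isCoprime_iff_sup_eq, sup_comm]
    exact hp.out.2 _ (lt_of_le_of_ne le_sup_left fun h =>
      hu (h.ge (mem_sup_right (mem_span_singleton_self u))))
  obtain ⟨a, ha, b, hb, hab⟩ := Ideal.isCoprime_iff_exists.1 (h.pow_right (n := n))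
  obtain ⟨v, rfl⟩ := Ideal.mem_span_singleton'.1 ha
  exact ⟨v, by rwa [← hab, add_sub_cancel_left]⟩

/-- Elements outside `p` act injectively on `p`-primary elements. -/
theorem eq_zero_of_mem_primaryPart {R : Type*} [CommRing R] {p : Ideal R} (hp : p.IsMaximal)
    {M : Type*} [AddCommGroup M] [Module R M] {x : M} (hx : x ∈ primaryPart p M) {u : R}
    (hu : u ∉ p) (hux : u • x = 0) : x = 0 := by
  obtain ⟨n, hn⟩ := hx
  obtain ⟨v, hv⟩ := exists_one_sub_mul_mem_pow hp hu n
  have := hn _ hv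
  rwa [sub_smul, mul_smul, hux, smul_zero, sub_zero, one_smul] at this

/-- Split off the exact power of `p` from `(u)` and take `β` in the cofactor, outside `p`. This
replaces localization at `p`, where `u` generates a power of `p`. -/
theorem exists_pow_mul_span_le {R : Type*} [CommRing R] [IsDedekindDomain R] {p : Ideal R}
    (hp : p.IsMaximal) {u : R} (hu : u ≠ 0) :
    ∃ n : ℕ, ∃ β ∉ p, p ^ n * Ideal.span {β} ≤ Ideal.span {u} := by
  have hfin : FiniteMultiplicity p (Ideal.span {u}) :=
    FiniteMultiplicity.of_not_isUnit (by simpa [Ideal.isUnit_iff] using hp.ne_top) (by simpa using hu)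
  obtain ⟨b, hb, hpb⟩ := hfin.exists_eq_pow_mul_and_not_dvd
  rw [Ideal.dvd_iff_le] at hpb
  obtain ⟨β, hβ, hβp⟩ := Set.not_subset.1 hpb
  refine ⟨multiplicity p (Ideal.span {u}), β, hβp, ?_⟩
  conv_rhs => rw [hb]
  exact Ideal.mul_mono_right ((Ideal.span_singleton_le_iff_mem _).2 hβ)

theorem exists_smul_mem_primaryPart {R : Type*} [CommRing R] [IsDedekindDomain R] {p : Ideal R}
    (hp : p.IsMaximal) {M : Type*} [AddCommGroup M] [Module R M] {x : M} {a : R} (ha : a ≠ 0)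
    (hax : a • x = 0) : ∃ β ∉ p, β • x ∈ primaryPart p M := by
  obtain ⟨n, β, hβ, h⟩ := exists_pow_mul_span_le hp ha
  refine ⟨β, hβ, n, fun c hc => ?_⟩
  obtain ⟨t, ht⟩ := Ideal.mem_span_singleton'.1
    (h (Ideal.mul_mem_mul hc (Ideal.mem_span_singleton_self β)))
  rw [smul_smul, ← ht, mul_smul, hax, smul_zero]

theorem pow_smul_top_eq_top {R : Type*} [CommRing R] {p : Ideal R} {M : Type*} [AddCommGroup M]
    [Module R M] (h : p • (⊤ : Submodule R M) = ⊤) (n : ℕ) : p ^ n • (⊤ : Submodule R M) = ⊤ := by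
  induction n with
  | zero => simp
  | succ n ih => rw [pow_succ, Submodule.mul_smul, h, ih]

/-- If `u ≠ 0` and `M = p M`, then `u M` contains a multiple of each element by something
outside of `p`. -/
theorem smul_mem_of_pow_mul_span_le {R : Type*} [CommRing R] {p : Ideal R} {M : Type*}
    [AddCommGroup M] [Module R M] (h : p • (⊤ : Submodule R M) = ⊤) {u β : R} {n : ℕ}
    (hβ : p ^ n * Ideal.span {β} ≤ Ideal.span {u}) (x : M) : ∃ y, u • y = β • x := by
  have hx : x ∈ p ^ n • (⊤ : Submodule R M) := by rw [pow_smul_top_eq_top h]; trivial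
  induction hx using Submodule.smul_induction_on' with
  | smul c hc m _ =>
    obtain ⟨t, ht⟩ := Ideal.mem_span_singleton'.1
      (hβ (Ideal.mul_mem_mul hc (Ideal.mem_span_singleton_self β)))
    exact ⟨t • m, by rw [smul_smul, smul_smul, mul_comm u, ht, mul_comm]⟩
  | add x _ y _ hx hy =>
    obtain ⟨a, ha⟩ := hx
    obtain ⟨b, hb⟩ := hy
    exact ⟨a + b, by rw [smul_add, smul_add, ha, hb]⟩

theorem primaryPart_divisible {R : Type*} [CommRing R] [IsDedekindDomain R] {p : Ideal R}
    (hp : p.IsMaximal) {M : Type*} [AddCommGroup M] [Module R M]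
    (h : p • (⊤ : Submodule R M) = ⊤) (u : R) (hu : u ≠ 0) (x : M) (hx : x ∈ primaryPart p M) :
    ∃ y ∈ primaryPart p M, u • y = x := by
  obtain ⟨n, β, hβ, hle⟩ := exists_pow_mul_span_le hp hu
  obtain ⟨l, hl⟩ := hx
  obtain ⟨v, hv⟩ := exists_one_sub_mul_mem_pow hp hβ l
  have hv' : ∀ x : M, (∀ a ∈ p ^ l, a • x = 0) → (v * β) • x = x := fun x hx => by
    have := hx _ hv
    rwa [sub_smul, one_smul, sub_eq_zero, eq_comm] at this
  obtain ⟨y, hy⟩ := smul_mem_of_pow_mul_span_le h hle (v • x)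
  have hyx : u • y = x := by rw [hy, smul_smul, mul_comm, hv' x hl]
  -- The scalar `v * β` fixes `x`, while its factor `β` removes the non-`p` part of the annihilator
  -- of `y`.
  refine ⟨(v * β) • y, ?_, by rw [smul_comm, hyx, hv' x hl]⟩
  refine ⟨l + n, fun c hc => ?_⟩
  have hc' : c * β ∈ p ^ l * Ideal.span {u} := by
    refine Ideal.mul_mono_right hle ?_
    rw [← mul_assoc, ← pow_add]
    exact Ideal.mul_mem_mul hc (Ideal.mem_span_singleton_self β)
  obtain ⟨t, ht, htc⟩ := Ideal.mem_mul_span_singleton.1 hc'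
  have : c * (v * β) = v * (t * u) := by rw [htc]; ring
  rw [smul_smul, this, mul_smul, mul_smul, hyx, hl t ht, smul_zero]

/-! ### Divisible modules and vanishing at `p` -/

/-- A divisible module over a Dedekind domain satisfies Baer's criterion. -/
theorem baer_of_divisible {R : Type*} [CommRing R] [IsDedekindDomain R] {D : Type*}
    [AddCommGroup D] [Module R D] (hD : ∀ r : R, r ≠ 0 → ∀ x : D, ∃ y, r • y = x) :
    Module.Baer R D := by
  intro I g
  by_cases hI : I = ⊥
  · subst hI
    refine ⟨0, fun x hx => ?_⟩
    have : (⟨x, hx⟩ : (⊥ : Ideal R)) = 0 := Subsingleton.elim _ _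
    rw [this, map_zero, LinearMap.zero_apply]
  -- `S` collects the `w` for which `w • g` extends to `R`. If `S ≤ p`, pick `a ∈ I` outside `p * I`
  -- and write `(a) = I * J`. Then `J` is not inside `p`, yet dividing `g a` by `a` shows `J ≤ S`.
  let S : Ideal R :=
    { carrier := {w | ∃ d : D, ∀ x : I, g (w • x) = (x : R) • d}
      zero_mem' := ⟨0, by simp⟩
      add_mem' := by
        rintro a b ⟨d, hd⟩ ⟨e, he⟩
        exact ⟨d + e, fun x => by rw [add_smul, map_add, hd, he, smul_add]⟩
      smul_mem' := by
        rintro c a ⟨d, hd⟩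
        exact ⟨c • d, fun x => by rw [smul_assoc, map_smul, hd, smul_comm]⟩ }
  have hS : S = ⊤ := by
    by_contra hS
    obtain ⟨p, hp, hSp⟩ := Ideal.exists_le_maximal S hS
    have hlt : ¬ I ≤ p * I := fun hle => by
      have h1 : p * I = 1 * I := by rw [one_mul]; exact le_antisymm Ideal.mul_le_right hle
      exact hp.ne_top ((mul_right_cancel₀ hI h1).trans Ideal.one_eq_top)
    obtain ⟨a, ha, haI⟩ := Set.not_subset.1 hlt
    obtain ⟨J, hJ⟩ := Ideal.dvd_iff_le.2 ((Ideal.span_singleton_le_iff_mem I).2 ha)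
    have ha0 : a ≠ 0 := by
      rintro rfl
      exact haI (zero_mem _)
    have hJp : ¬ J ≤ p := fun hle => haI <| by
      have : Ideal.span {a} ≤ p * I := by
        rw [hJ, mul_comm]
        exact Ideal.mul_mono_left hle
      exact this (Ideal.mem_span_singleton_self a)
    obtain ⟨w, hw, hwp⟩ := Set.not_subset.1 hJp
    refine hwp (hSp ?_)
    obtain ⟨d, hd⟩ := hD a ha0 (g ⟨a, ha⟩)
    refine ⟨w • d, fun x => ?_⟩
    have hx : (x : R) * w ∈ Ideal.span {a} := hJ ▸ Ideal.mul_mem_mul x.2 hw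
    obtain ⟨e, he⟩ := Ideal.mem_span_singleton'.1 hx
    have hwx : w • x = e • (⟨a, ha⟩ : I) := Subtype.ext (by simp [he, mul_comm])
    rw [hwx, map_smul, ← hd, smul_smul, smul_smul, he]
  obtain ⟨d, hd⟩ : (1 : R) ∈ S := hS ▸ trivial
  refine ⟨LinearMap.toSpanSingleton R D d, fun x hx => ?_⟩
  have := hd ⟨x, hx⟩
  rw [one_smul] at this
  rw [this, LinearMap.toSpanSingleton_apply]

/-- A regularly weakly based module has no non-zero divisible submodule. -/
theorem RegularlyWeaklyBased.eq_bot_of_divisible {R M : Type*} [CommRing R] [IsDedekindDomain R]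
    (hR : ¬ IsField R) [AddCommGroup M] [Module R M] (hM : RegularlyWeaklyBased R M)
    {D : Submodule R M} (hD : ∀ r : R, r ≠ 0 → ∀ x ∈ D, ∃ y ∈ D, r • y = x) : D = ⊥ := by
  have hB : Module.Baer R D := baer_of_divisible fun r hr x => by
    obtain ⟨y, hy, hyx⟩ := hD r hr x x.2
    exact ⟨⟨y, hy⟩, Subtype.ext hyx⟩
  obtain ⟨π, hπ⟩ := hB.extension_property D.subtype D.subtype_injective LinearMap.id
  have hc : IsCompl D (LinearMap.ker π) :=
    LinearMap.isCompl_of_proj fun x => LinearMap.congr_fun hπ x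
  have htop := hM.eq_top_of_sup_divisible hR hD hc.symm.sup_eq_top
  have := hc.inf_eq_bot
  rwa [htop, inf_top_eq] at this

theorem RegularlyWeaklyBased.primaryPart_eq_bot {R M : Type*} [CommRing R] [IsDedekindDomain R]
    (hR : ¬ IsField R) [AddCommGroup M] [Module R M] (hM : RegularlyWeaklyBased R M) {p : Ideal R}
    (hp : p.IsMaximal) (h : p • (⊤ : Submodule R M) = ⊤) : primaryPart p M = ⊥ :=
  hM.eq_bot_of_divisible hR (primaryPart_divisible hp h)

theorem smul_top_quotient_eq_top {R M : Type*} [CommRing R] [AddCommGroup M] [Module R M]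
    {I : Ideal R} {L : Submodule R M} (h : L ⊔ I • (⊤ : Submodule R M) = ⊤) :
    I • (⊤ : Submodule R (M ⧸ L)) = ⊤ := by
  have : map L.mkQ (I • (⊤ : Submodule R M)) = ⊤ := (Submodule.map_mkQ_eq_top _ _).2 h
  rwa [Submodule.map_smul'', Submodule.map_top, Submodule.range_mkQ] at this

/-- If `M` is regularly weakly based and `M = p M`, then `M` localized at `p` vanishes. -/
theorem RegularlyWeaklyBased.exists_notMem_smul_eq_zero {R M : Type*} [CommRing R]
    [IsDedekindDomain R] (hR : ¬ IsField R) [AddCommGroup M] [Module R M]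
    (hM : RegularlyWeaklyBased R M) {p : Ideal R} (hp : p.IsMaximal)
    (h : p • (⊤ : Submodule R M) = ⊤) (x : M) : ∃ u ∉ p, u • x = 0 := by
  obtain ⟨s, hsp, hs0⟩ := Submodule.exists_mem_ne_zero_of_ne_bot
    (Ring.ne_bot_of_isMaximal_of_not_isField hp hR)
  -- Solve `s • y = β • x`. Modulo `x` the element `β • y` is primary, hence zero, so `β • y = c •
  -- x` and `β * β - s * c`, which lies outside `p`, kills `x`.
  obtain ⟨n, β, hβ, hle⟩ := exists_pow_mul_span_le hp hs0
  obtain ⟨y, hy⟩ := smul_mem_of_pow_mul_span_le h hle x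
  have hbot := (hM.quotient_of_fg (fg_span_singleton x)).primaryPart_eq_bot hR hp
    (smul_top_quotient_eq_top (by rw [h, sup_top_eq]))
  have hβy : (span R {x}).mkQ (β • y) ∈ primaryPart p (M ⧸ span R {x}) := by
    refine ⟨n, fun c hc => ?_⟩
    obtain ⟨t, ht⟩ := Ideal.mem_span_singleton'.1
      (hle (Ideal.mul_mem_mul hc (Ideal.mem_span_singleton_self β)))
    rw [← map_smul, smul_smul, ← ht, mul_smul, hy, smul_smul]
    exact (Submodule.Quotient.mk_eq_zero _).2 (smul_mem _ _ (mem_span_singleton_self x))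
  rw [hbot, mem_bot] at hβy
  have hβy' : β • y ∈ span R {x} := (Submodule.Quotient.mk_eq_zero _).1 hβy
  obtain ⟨c, hc⟩ := mem_span_singleton.1 hβy'
  refine ⟨β * β - s * c, fun hmem => ?_, ?_⟩
  · have h2 : β * β ∈ p := by
      have := add_mem hmem (Ideal.mul_mem_right c p hsp)
      rwa [sub_add_cancel] at this
    exact (hp.isPrime.mem_or_mem h2).elim hβ hβ
  · rw [sub_smul, mul_smul, mul_smul, hc, ← hy, smul_comm, sub_self]

/-- The range condition gives `ker f + p M = M`, so a basis of `M / pM` lifts to a set `k` in `ker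
f`. The quotient by `span R k` vanishes locally at `p`, and `f` factors through it into `p`-primary
elements. -/
theorem RegularlyWeaklyBased.eq_zero_of_range_le_smul {R M W : Type*} [CommRing R]
    [IsDedekindDomain R] (hR : ¬ IsField R) [AddCommGroup M] [Module R M] [AddCommGroup W]
    [Module R W] (hM : RegularlyWeaklyBased R M) {p : Ideal R} (hp : p.IsMaximal)
    (f : M →ₗ[R] W) (hf : ∀ x, f x ∈ primaryPart p W)
    (hrange : LinearMap.range f ≤ p • LinearMap.range f) : f = 0 := by
  let := Ideal.Quotient.field p
  let q := (p • (⊤ : Submodule R M)).mkQ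
  obtain ⟨b, hbt, hbs, hbi⟩ := exists_linearIndependent (R ⧸ p)
    (q '' (LinearMap.ker f : Set M))
  choose g hg using fun z : b => hbt z.2
  have hspan : ∀ s : Set (M ⧸ p • (⊤ : Submodule R M)),
      (span (R ⧸ p) s).restrictScalars R = span R s := fun s =>
    restrictScalars_span R (R ⧸ p) Ideal.Quotient.mk_surjective s
  set k : Set M := Set.range g with hk
  have hkf : span R k ≤ LinearMap.ker f := by
    rw [span_le]
    rintro _ ⟨z, rfl⟩
    exact (hg z).1
  have hsup : span R k ⊔ p • (⊤ : Submodule R M) = ⊤ := by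
    have h1 : map q (LinearMap.ker f) = ⊤ := by
      rw [Submodule.map_mkQ_eq_top, eq_top_iff]
      rintro m -
      have hm : f m ∈ map f (p • (⊤ : Submodule R M)) := by
        rw [Submodule.map_smul'', Submodule.map_top]
        exact hrange ⟨m, rfl⟩
      obtain ⟨m', hm', hmm⟩ := hm
      rw [← add_sub_cancel m' m]
      exact add_mem (mem_sup_left hm') (mem_sup_right (by simp [hmm]))
    have h2 : map q (span R k) = ⊤ := by
      have hkb : q '' k = b := by
        ext z
        constructor
        · rintro ⟨_, ⟨w, rfl⟩, rfl⟩
          rw [(hg w).2]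
          exact w.2
        · intro hz
          exact ⟨g ⟨z, hz⟩, ⟨_, rfl⟩, (hg ⟨z, hz⟩).2⟩
      rw [map_span, hkb, ← hspan, hbs, hspan, ← map_span, span_eq, h1]
    rw [Submodule.map_mkQ_eq_top] at h2
    rwa [sup_comm]
  have hforced : ∀ x ∈ k, x ∉ span R (k \ {x}) ⊔ p • (⊤ : Submodule R M) := by
    rintro _ ⟨z, rfl⟩ hmem
    have h1 : (z : M ⧸ p • (⊤ : Submodule R M)) ∈ span (R ⧸ p) (b \ {(z : M ⧸ p • ⊤)}) := by
      obtain ⟨y, hy, w, hw, hyw⟩ := mem_sup.1 hmem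
      have hqy : q y = z := by
        have hw0 : q w = 0 := by simpa [q] using hw
        rw [← (hg z).2, ← hyw, map_add, hw0, add_zero]
      have h2 : map q (span R (k \ {g z})) ≤ span R (b \ {(z : M ⧸ p • ⊤)}) := by
        rw [map_span]
        refine span_mono ?_
        rintro _ ⟨_, ⟨⟨v, rfl⟩, hv⟩, rfl⟩
        rw [(hg v).2]
        refine ⟨v.2, fun h => hv ?_⟩
        rw [Set.mem_singleton_iff, Subtype.ext h]
      have h3 := h2 ⟨y, hy, hqy⟩
      rwa [← hspan] at h3
    refine hbi.notMem_span_image (s := {z}ᶜ) (x := z) (by simp) ?_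
    have himg : ((↑) : b → M ⧸ p • (⊤ : Submodule R M)) '' {z}ᶜ = b \ {(z : M ⧸ p • ⊤)} := by
      ext w
      simp [and_comm]
    rw [himg]
    exact h1
  have hL := hM.quotient_span p k hforced hsup
  ext m
  obtain ⟨u, hu, hum⟩ := hL.exists_notMem_smul_eq_zero hR hp (smul_top_quotient_eq_top hsup)
    ((span R k).mkQ m)
  rw [← map_smul] at hum
  have : f (u • m) = 0 := hkf ((Submodule.Quotient.mk_eq_zero _).1 hum)
  rw [map_smul] at this
  exact eq_zero_of_mem_primaryPart hp (hf m) hu this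

/-! ### The module `K / R` as a test object -/

/-- The quotient `K / R` of the fraction field of `R` by `R`. -/
abbrev FractionQuotient (R : Type*) [CommRing R] : Type _ :=
  FractionRing R ⧸ LinearMap.range (Algebra.linearMap R (FractionRing R))

theorem FractionQuotient.divisible {R : Type*} [CommRing R] [IsDomain R] (r : R) (hr : r ≠ 0)
    (x : FractionQuotient R) : ∃ y, r • y = x := by
  obtain ⟨k, rfl⟩ := Submodule.mkQ_surjective _ x
  refine ⟨Submodule.mkQ _ ((algebraMap R (FractionRing R) r)⁻¹ * k), ?_⟩
  rw [← map_smul, Algebra.smul_def, mul_inv_cancel_left₀]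
  simpa using hr

/-- For a representative `c` of `h`, the annihilator of `h` is the inverse of the fractional ideal
`F = R c + R`; the claim is `F⁻¹⁻¹ = F`. -/
theorem FractionQuotient.mem_span_singleton_of_forall_smul_eq_zero {R : Type*} [CommRing R]
    [IsDedekindDomain R] {g h : FractionQuotient R} (H : ∀ r : R, r • h = 0 → r • g = 0) :
    g ∈ span R {h} := by
  obtain ⟨a, rfl⟩ := Submodule.mkQ_surjective _ g
  obtain ⟨c, rfl⟩ := Submodule.mkQ_surjective _ h
  have hmk : ∀ (r : R) (x : FractionRing R),
      r • (LinearMap.range (Algebra.linearMap R (FractionRing R))).mkQ x = 0 ↔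
        ∃ t : R, algebraMap R (FractionRing R) t = algebraMap R (FractionRing R) r * x := by
    intro r x
    rw [← map_smul, Algebra.smul_def]
    exact Submodule.Quotient.mk_eq_zero _
  let F : FractionalIdeal (nonZeroDivisors R) (FractionRing R) :=
    FractionalIdeal.spanSingleton _ c + 1
  have h1F : (1 : FractionRing R) ∈ F := by
    rw [FractionalIdeal.mem_add]
    exact ⟨0, FractionalIdeal.zero_mem _, 1, FractionalIdeal.one_mem_one _, zero_add _⟩
  have hcF : c ∈ F := by
    rw [FractionalIdeal.mem_add]
    exact ⟨c, FractionalIdeal.mem_spanSingleton_self _ _, 0, FractionalIdeal.zero_mem _, add_zero _⟩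
  have hF : F ≠ 0 := by
    intro h0
    rw [h0] at h1F
    exact one_ne_zero ((FractionalIdeal.mem_zero_iff _).1 h1F)
  have haF : a ∈ F := by
    rw [← inv_inv F, FractionalIdeal.mem_inv_iff (inv_ne_zero hF)]
    intro y hy
    rw [FractionalIdeal.mem_inv_iff hF] at hy
    obtain ⟨r, hr⟩ := (FractionalIdeal.mem_one_iff _).1 (hy 1 h1F)
    rw [mul_one] at hr
    obtain ⟨t, ht⟩ := (FractionalIdeal.mem_one_iff _).1 (hy c hcF)
    have := (hmk r a).1 (H r ((hmk r c).2 ⟨t, by rw [ht, hr]⟩))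
    rw [hr, mul_comm] at this
    exact (FractionalIdeal.mem_one_iff _).2 this
  obtain ⟨b, hb, d, hd, rfl⟩ := (FractionalIdeal.mem_add _ _ _).1 haF
  obtain ⟨t, rfl⟩ := (FractionalIdeal.mem_spanSingleton _).1 hb
  obtain ⟨u, rfl⟩ := (FractionalIdeal.mem_one_iff _).1 hd
  refine mem_span_singleton.2 ⟨t, ?_⟩
  have hu : (LinearMap.range (Algebra.linearMap R (FractionRing R))).mkQ
      (algebraMap R (FractionRing R) u) = 0 := (Submodule.Quotient.mk_eq_zero _).2 ⟨u, rfl⟩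
  rw [map_add, hu, add_zero, map_smul]

theorem FractionQuotient.exists_ne_zero {R : Type*} [CommRing R] [IsDedekindDomain R] {p : Ideal R}
    (hp0 : p ≠ ⊥) (hp1 : p ≠ ⊤) : ∃ e : FractionQuotient R, e ≠ 0 ∧ ∀ a ∈ p, a • e = 0 := by
  obtain ⟨x, hx, hx1⟩ :=
    FractionalIdeal.exists_notMem_one_of_ne_bot (K := FractionRing R) hp0 hp1
  refine ⟨Submodule.mkQ _ x, fun h => hx1 ?_, fun a ha => ?_⟩
  · obtain ⟨t, ht⟩ := (Submodule.Quotient.mk_eq_zero _).1 h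
    exact (FractionalIdeal.mem_one_iff _).2 ⟨t, ht⟩
  · rw [FractionalIdeal.mem_inv_iff (FractionalIdeal.coeIdeal_ne_zero.2 hp0)] at hx
    obtain ⟨t, ht⟩ := (FractionalIdeal.mem_one_iff _).1
      (hx _ (FractionalIdeal.mem_coeIdeal_of_mem _ ha))
    rw [← map_smul, Algebra.smul_def]
    exact (Submodule.Quotient.mk_eq_zero _).2 ⟨t, by rw [mul_comm, ← ht]; rfl⟩

theorem FractionQuotient.primaryPart_divisible {R : Type*} [CommRing R] [IsDedekindDomain R]
    {p : Ideal R} (hp : p.IsMaximal) (hp0 : p ≠ ⊥) (r : R) (hr : r ≠ 0)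
    (x : primaryPart p (FractionQuotient R)) : ∃ y, r • y = x := by
  obtain ⟨s, hsp, hs0⟩ := Submodule.exists_mem_ne_zero_of_ne_bot hp0
  have htop : p • (⊤ : Submodule R (FractionQuotient R)) = ⊤ := by
    rw [eq_top_iff]
    rintro x -
    obtain ⟨y, rfl⟩ := FractionQuotient.divisible s hs0 x
    exact smul_mem_smul hsp trivial
  obtain ⟨y, hy, hyx⟩ := _root_.primaryPart_divisible hp htop r hr x x.2
  exact ⟨⟨y, hy⟩, Subtype.ext hyx⟩

theorem FractionQuotient.exists_primaryPart_ne_zero {R : Type*} [CommRing R] [IsDedekindDomain R]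
    {p : Ideal R} (hp : p.IsMaximal) (hp0 : p ≠ ⊥) :
    ∃ e : primaryPart p (FractionQuotient R), e ≠ 0 ∧ ∀ a ∈ p, a • e = 0 := by
  obtain ⟨e, he, h⟩ := FractionQuotient.exists_ne_zero hp0 hp.ne_top
  exact ⟨⟨e, 1, fun a ha => h a (by simpa using ha)⟩, fun h0 => he (congrArg Subtype.val h0),
    fun a ha => Subtype.ext (h a ha)⟩

/-- The primary parts of `K / R` are cogenerators for primary modules. -/
theorem exists_linearMap_primaryPart_ne_zero {R : Type*} [CommRing R] [IsDedekindDomain R]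
    {p : Ideal R} (hp : p.IsMaximal) (hp0 : p ≠ ⊥) {M : Type*} [AddCommGroup M] [Module R M]
    {z : M} (hz : z ∈ primaryPart p M) (hz0 : z ≠ 0) :
    ∃ f : M →ₗ[R] primaryPart p (FractionQuotient R), f z ≠ 0 := by
  obtain ⟨e, he0, he⟩ := FractionQuotient.exists_primaryPart_ne_zero hp hp0
  let φ : (R ⧸ Ideal.torsionOf R M z) →ₗ[R] primaryPart p (FractionQuotient R) :=
    (Ideal.torsionOf R M z).liftQ (LinearMap.toSpanSingleton R _ e) fun r hr => by
      have hrp : r ∈ p := by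
        by_contra hrp
        exact hz0 (eq_zero_of_mem_primaryPart hp hz hrp ((Ideal.mem_torsionOf_iff z r).1 hr))
      simpa using he r hrp
  let ψ := Ideal.quotTorsionOfEquivSpanSingleton R M z
  obtain ⟨f, hf⟩ := (baer_of_divisible
    (FractionQuotient.primaryPart_divisible hp hp0)).extension_property (span R {z}).subtype
    (subtype_injective _) (φ ∘ₗ ψ.symm.toLinearMap)
  have hψ : ψ.symm ⟨z, mem_span_singleton_self z⟩ = Submodule.Quotient.mk 1 := by
    rw [LinearEquiv.symm_apply_eq, Ideal.quotTorsionOfEquivSpanSingleton_apply_mk, one_smul]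
  have := LinearMap.congr_fun hf ⟨z, mem_span_singleton_self z⟩
  simp only [LinearMap.comp_apply, subtype_apply, LinearEquiv.coe_coe] at this
  refine ⟨f, ?_⟩
  rw [this, hψ, show φ (Submodule.Quotient.mk 1) = (1 : R) • e from rfl, one_smul]
  exact he0

/-! ### Boundedness of homomorphisms and of primary parts -/

/-- Homomorphisms from a regularly weakly based module to a primary part of `K / R` are bounded. -/
theorem RegularlyWeaklyBased.exists_pow_smul_eq_zero {R M : Type*} [CommRing R]
    [IsDedekindDomain R] (hR : ¬ IsField R) [AddCommGroup M] [Module R M]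
    (hM : RegularlyWeaklyBased R M) {p : Ideal R} (hp : p.IsMaximal)
    (f : M →ₗ[R] primaryPart p (FractionQuotient R)) :
    ∃ n : ℕ, ∀ a ∈ p ^ n, ∀ x, a • f x = 0 := by
  by_contra! hunb
  have hp0 := Ring.ne_bot_of_isMaximal_of_not_isField hp hR
  let g : M →ₗ[R] FractionQuotient R := (primaryPart p (FractionQuotient R)).subtype ∘ₗ f
  have hg : ∀ x, g x ∈ primaryPart p (FractionQuotient R) := fun x => (f x).2
  have hg0 : g = 0 := by
    refine hM.eq_zero_of_range_le_smul hR hp g hg ?_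
    rintro _ ⟨m, rfl⟩
    obtain ⟨N, hN⟩ := hg m
    obtain ⟨a, ha, x, hax⟩ := hunb (N + 1)
    -- The annihilator of `g (s • x)` is a power of `p` with exponent at least `N`, so `g m` is a
    -- multiple of `s • g x`, hence in `p` times the range.
    obtain ⟨c, hc, s, hs, hcs⟩ : ∃ c ∈ p ^ N, ∃ s ∈ p, (c * s) • g x ≠ 0 := by
      by_contra! h
      have hle : p ^ N * p ≤ Ideal.torsionOf R _ (g x) :=
        Ideal.mul_le.2 fun c hc s hs => (Ideal.mem_torsionOf_iff _ _).2 (h c hc s hs)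
      rw [← pow_succ] at hle
      exact hax (Subtype.ext ((Ideal.mem_torsionOf_iff _ _).1 (hle ha)))
    obtain ⟨l, hl⟩ := hg (s • x)
    have hdvd : Ideal.torsionOf R _ (g (s • x)) ∣ p ^ l :=
      Ideal.dvd_iff_le.2 fun r hr => (Ideal.mem_torsionOf_iff _ _).2 (hl r hr)
    have hprime : Prime p := Ideal.prime_of_isPrime hp0 hp.isPrime
    obtain ⟨j, -, hj⟩ := (dvd_prime_pow hprime l).1 hdvd
    rw [associated_iff_eq] at hj
    have hNj : N ≤ j := by
      by_contra! hlt
      refine hcs ?_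
      have : c ∈ Ideal.torsionOf R _ (g (s • x)) := hj ▸ Ideal.pow_le_pow_right hlt.le hc
      rw [Ideal.mem_torsionOf_iff, map_smul, smul_smul] at this
      exact this
    obtain ⟨t, ht⟩ := mem_span_singleton.1
      (FractionQuotient.mem_span_singleton_of_forall_smul_eq_zero (g := g m) (h := g (s • x))
        fun r hr => hN r (Ideal.pow_le_pow_right hNj (hj ▸ (Ideal.mem_torsionOf_iff _ _).2 hr)))
    rw [← ht, map_smul, smul_comm, ← map_smul]
    exact smul_mem_smul hs ⟨_, rfl⟩
  obtain ⟨a, -, x, hax⟩ := hunb 0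
  exact hax (Subtype.ext (by
    have : (f x : FractionQuotient R) = 0 := LinearMap.congr_fun hg0 x
    simp [this]))

theorem RegularlyWeaklyBased.not_linearIndependent_nat {R M : Type*} [CommRing R]
    [IsDedekindDomain R] (hR : ¬ IsField R) [AddCommGroup M] [Module R M]
    (hM : RegularlyWeaklyBased R M) (v : ℕ → M) : ¬ LinearIndependent R v := by
  intro hv
  obtain ⟨p, hp⟩ := Ideal.exists_maximal R
  have hp0 := Ring.ne_bot_of_isMaximal_of_not_isField hp hR
  obtain ⟨s, hsp, hs0⟩ := Submodule.exists_mem_ne_zero_of_ne_bot hp0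
  obtain ⟨e₀, he₀, -⟩ := FractionQuotient.exists_primaryPart_ne_zero hp hp0
  -- Sending `v n` to `e n` extends to an unbounded homomorphism on `M`, since `s ^ n • e n = e₀ ≠
  -- 0`.
  choose e he using fun n : ℕ =>
    FractionQuotient.primaryPart_divisible hp hp0 (s ^ n) (pow_ne_zero n hs0) e₀
  obtain ⟨f, hf⟩ := (baer_of_divisible
    (FractionQuotient.primaryPart_divisible hp hp0)).extension_property
    (Finsupp.linearCombination R v) hv (Finsupp.linearCombination R e)
  obtain ⟨n, hn⟩ := hM.exists_pow_smul_eq_zero hR hp f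
  have h1 : f (v n) = e n := by
    simpa using LinearMap.congr_fun hf (Finsupp.single n 1)
  have h2 := hn (s ^ n) (Ideal.pow_mem_pow hsp n) (v n)
  rw [h1, he] at h2
  exact he₀ h2

/-- If an unbounded `s`-primary module is cogenerated by `E`, then it has an unbounded homomorphism
to `E`. -/
theorem exists_unbounded_linearMap {R T E : Type*} [CommRing R] [AddCommGroup T] [Module R T]
    [AddCommGroup E] [Module R E] (s : R) (htors : ∀ x : T, ∃ n : ℕ, s ^ n • x = 0)
    (hunb : ∀ n : ℕ, ∃ x : T, s ^ n • x ≠ 0)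
    (hE : ∀ z : T, z ≠ 0 → ∃ f : T →ₗ[R] E, f z ≠ 0) :
    ∃ f : T →ₗ[R] E, ∀ n : ℕ, ∃ x, s ^ n • f x ≠ 0 := by
  by_contra! H
  -- Gliding hump: `q` holds a partial sum and an exponent. The new term makes `s ^ n` nonzero at
  -- `x`, and the new exponent kills `x`, so later terms leave that value unchanged. The pointwise
  -- limit `F` is then unbounded.
  have step : ∀ (n : ℕ) (q : (T →ₗ[R] E) × ℕ), ∃ (f : T →ₗ[R] E) (x : T) (e : ℕ),
      q.2 ≤ e ∧ n ≤ e ∧ s ^ e • x = 0 ∧ s ^ n • (q.1 + s ^ q.2 • f) x ≠ 0 := by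
    rintro n ⟨g, e⟩
    obtain ⟨b, hb⟩ := H g
    obtain ⟨x, hx⟩ := hunb (n + b + e)
    obtain ⟨f, hf⟩ := hE _ hx
    obtain ⟨l, hl⟩ := htors x
    refine ⟨f, x, l + n + e, by omega, by omega, ?_, fun h0 => hf ?_⟩
    · rw [show l + n + e = (n + e) + l by omega, pow_add, mul_smul, hl, smul_zero]
    · have h1 : s ^ b • s ^ n • (g + s ^ e • f) x = 0 := by rw [h0, smul_zero]
      rw [LinearMap.add_apply, smul_comm, smul_add, hb, zero_add, LinearMap.smul_apply, smul_smul,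
        smul_smul, ← pow_add, ← pow_add, ← map_smul] at h1
      rwa [show n + b + e = n + (b + e) by omega, ← add_assoc] at *
  choose f x e hqe hne hex hfx using step
  let σ : ℕ → (T →ₗ[R] E) × ℕ := fun n =>
    Nat.rec (0, 0) (fun n q => (q.1 + s ^ q.2 • f n q, e n q)) n
  have hσ : ∀ n, σ (n + 1) = ((σ n).1 + s ^ (σ n).2 • f n (σ n), e n (σ n)) := fun n => rfl
  have hmono : Monotone fun n => (σ n).2 := monotone_nat_of_le_succ fun n => by
    simpa [hσ] using hqe n (σ n)
  have hle : ∀ n, n ≤ (σ (n + 1)).2 := fun n => by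
    rw [hσ]
    exact hne n (σ n)
  have hpow : ∀ {t : T} {m n : ℕ}, m ≤ n → s ^ m • t = 0 → s ^ n • t = 0 := by
    intro t m n hmn h
    obtain ⟨k, rfl⟩ := Nat.exists_eq_add_of_le' hmn
    rw [pow_add, mul_smul, h, smul_zero]
  have hstab : ∀ (t : T) (n m : ℕ), s ^ (σ n).2 • t = 0 → n ≤ m → (σ m).1 t = (σ n).1 t := by
    intro t n m ht hnm
    induction m, hnm using Nat.le_induction with
    | base => rfl
    | succ m hnm ih =>
      rw [hσ, LinearMap.add_apply, ih, LinearMap.smul_apply, ← map_smul,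
        hpow (hmono hnm) ht, map_zero, add_zero]
  choose l hl using htors
  have hlim : ∀ (t : T) (n : ℕ), s ^ (σ n).2 • t = 0 → (σ (l t + 1)).1 t = (σ n).1 t := by
    intro t n hn
    rw [← hstab t n (max n (l t + 1)) hn (le_max_left _ _),
      hstab t (l t + 1) (max n (l t + 1)) (hpow (hle _) (hl t)) (le_max_right _ _)]
  let F : T →ₗ[R] E :=
    { toFun := fun t => (σ (l t + 1)).1 t
      map_add' := by
        intro a b
        let m := l a + l b + 1
        have ha : s ^ (σ m).2 • a = 0 := hpow ((by omega : l a ≤ l a + l b).trans (hle _)) (hl a)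
        have hb : s ^ (σ m).2 • b = 0 := hpow ((by omega : l b ≤ l a + l b).trans (hle _)) (hl b)
        rw [hlim a m ha, hlim b m hb, hlim (a + b) m (by rw [smul_add, ha, hb, add_zero]), map_add]
      map_smul' := by
        intro c a
        have ha : s ^ (σ (l a + 1)).2 • a = 0 := hpow (hle _) (hl a)
        rw [hlim (c • a) (l a + 1) (by rw [smul_comm, ha, smul_zero]), map_smul, RingHom.id_apply] }
  obtain ⟨b, hb⟩ := H F
  refine hfx b (σ b) ?_
  have : F (x b (σ b)) = (σ (b + 1)).1 (x b (σ b)) :=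
    hlim _ (b + 1) (hex b (σ b))
  rw [hσ] at this
  rw [← hb (x b (σ b)), this]

theorem RegularlyWeaklyBased.exists_pow_smul_primaryPart_eq_zero {R M : Type*} [CommRing R]
    [IsDedekindDomain R] (hR : ¬ IsField R) [AddCommGroup M] [Module R M]
    (hM : RegularlyWeaklyBased R M) {p : Ideal R} (hp : p.IsMaximal) {s : R} (hs : s ∈ p) :
    ∃ n : ℕ, ∀ x ∈ primaryPart p M, s ^ n • x = 0 := by
  by_contra! hunb
  have hp0 := Ring.ne_bot_of_isMaximal_of_not_isField hp hR
  have hprim : ∀ x : primaryPart p M, x ∈ primaryPart p (primaryPart p M) := by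
    rintro ⟨x, n, hn⟩
    exact ⟨n, fun a ha => Subtype.ext (hn a ha)⟩
  obtain ⟨f, hf⟩ := exists_unbounded_linearMap (R := R) (T := primaryPart p M)
    (E := primaryPart p (FractionQuotient R)) s
    (fun x => by
      obtain ⟨n, hn⟩ := hprim x
      exact ⟨n, hn _ (Ideal.pow_mem_pow hs n)⟩)
    (fun n => by
      obtain ⟨x, hx, h⟩ := hunb n
      exact ⟨⟨x, hx⟩, fun h0 => h (congrArg Subtype.val h0)⟩)
    (fun z hz => exists_linearMap_primaryPart_ne_zero hp hp0 (hprim z) hz)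
  obtain ⟨g, hg⟩ := (baer_of_divisible
    (FractionQuotient.primaryPart_divisible hp hp0)).extension_property (primaryPart p M).subtype
    (subtype_injective _) f
  obtain ⟨n, hn⟩ := hM.exists_pow_smul_eq_zero hR hp g
  obtain ⟨x, hx⟩ := hf n
  rw [← hg] at hx
  exact hx (hn _ (Ideal.pow_mem_pow hs n) _)

/-! ### Torsion modules -/

theorem RegularlyWeaklyBased.exists_linearMap_range_le_span_singleton {R M : Type*} [CommRing R]
    [IsDedekindDomain R] (hR : ¬ IsField R) [AddCommGroup M] [Module R M]
    (hM : RegularlyWeaklyBased R M) (hT : ∀ x : M, ∃ a : R, a ≠ 0 ∧ a • x = 0)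
    {p : Ideal R} (hp : p.IsMaximal) (hbot : primaryPart p M ≠ ⊥) :
    ∃ f : M →ₗ[R] FractionQuotient R, (∀ a ∈ p, ∀ m, a • f m = 0) ∧
      ∃ x ∈ primaryPart p M, f x ≠ 0 ∧ ∀ m, f m ∈ span R {f x} := by
  have hp0 := Ring.ne_bot_of_isMaximal_of_not_isField hp hR
  obtain ⟨z, hz, hz0⟩ := Submodule.exists_mem_ne_zero_of_ne_bot hbot
  obtain ⟨f, hf⟩ := exists_linearMap_primaryPart_ne_zero hp hp0 hz hz0
  have hex := hM.exists_pow_smul_eq_zero hR hp f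
  classical
  -- With `k + 1` the least bounding exponent, scaling `f` by a suitable element of `p ^ k` gives a
  -- nonzero map killed by `p`.
  obtain ⟨k, hk⟩ : ∃ k, Nat.find hex = k + 1 := by
    refine Nat.exists_eq_succ_of_ne_zero fun h0 => hf ?_
    have := Nat.find_spec hex 1 (by simp [h0]) z
    rwa [one_smul] at this
  have hspec := Nat.find_spec hex
  have hmin := Nat.find_min hex (m := k) (by omega)
  rw [hk] at hspec
  push Not at hmin
  obtain ⟨a, ha, m, ham⟩ := hmin
  let g : M →ₗ[R] FractionQuotient R := (primaryPart p (FractionQuotient R)).subtype ∘ₗ (a • f)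
  have hgp : ∀ c ∈ p, ∀ m, c • g m = 0 := by
    intro c hc m
    have : (c * a) • f m = 0 :=
      hspec _ (by rw [pow_succ, mul_comm c]; exact Ideal.mul_mem_mul ha hc) m
    rw [mul_smul] at this
    exact congrArg Subtype.val this
  have hgprim : ∀ m, g m ∈ primaryPart p (FractionQuotient R) := fun m =>
    ⟨1, fun c hc => hgp c (by simpa using hc) m⟩
  have hgm : g m ≠ 0 := fun h => ham (Subtype.ext h)
  obtain ⟨b, hb0, hbm⟩ := hT m
  obtain ⟨β, hβ, hβm⟩ := exists_smul_mem_primaryPart hp hb0 hbm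
  have hgx : g (β • m) ≠ 0 := fun h =>
    hgm (eq_zero_of_mem_primaryPart hp (hgprim m) hβ (by rwa [map_smul] at h))
  refine ⟨g, hgp, β • m, hβm, hgx, fun m' =>
    FractionQuotient.mem_span_singleton_of_forall_smul_eq_zero fun r hr => hgp r ?_ m'⟩
  by_contra hrp
  exact hgx (eq_zero_of_mem_primaryPart hp (hgprim _) hrp hr)

theorem exists_notMem_smul_sum_eq_zero {R M ι : Type*} [CommRing R] [AddCommGroup M] [Module R M]
    {p : Ideal R} (hp : p.IsPrime) (x : ι → M) (t : Finset ι)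
    (h : ∀ i ∈ t, ∃ u ∉ p, u • x i = 0) : ∃ u ∉ p, u • ∑ i ∈ t, x i = 0 := by
  choose! u hu hux using h
  classical
  refine ⟨∏ i ∈ t, u i, fun hmem => ?_, ?_⟩
  · obtain ⟨i, hi, him⟩ := hp.prod_mem_iff.1 hmem
    exact hu i hi him
  · rw [Finset.smul_sum]
    refine Finset.sum_eq_zero fun i hi => ?_
    rw [← Finset.prod_erase_mul _ _ hi, mul_smul, hux i hi, smul_zero]

/-- Given infinitely many such primes, coprimality of annihilators makes each partial sum `c n` of
the `x i` a multiple of the next. Together with the common kernel of the `f i` these sums span `M`,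
so one `c n` suffices; but `f n` kills `c n` and not `x n`. -/
theorem RegularlyWeaklyBased.finite_primaryPart_ne_bot {R M : Type*} [CommRing R]
    [IsDedekindDomain R] (hR : ¬ IsField R) [AddCommGroup M] [Module R M]
    (hM : RegularlyWeaklyBased R M) (hT : ∀ x : M, ∃ a : R, a ≠ 0 ∧ a • x = 0) :
    {v : HeightOneSpectrum R | primaryPart v.asIdeal M ≠ ⊥}.Finite := by
  by_contra hinf
  let v : ℕ ↪ _ := Set.Infinite.natEmbedding _ hinf
  let p : ℕ → Ideal R := fun i => (v i).1.asIdeal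
  have hp : ∀ i, (p i).IsMaximal := fun i => (v i).1.isMaximal
  have hpinj : Function.Injective p := fun i j h =>
    v.injective (Subtype.ext (HeightOneSpectrum.ext h))
  choose f hfp x hx hfx hspan using fun i =>
    hM.exists_linearMap_range_le_span_singleton hR hT (hp i) (v i).2
  have hfprim : ∀ i m, f i m ∈ primaryPart (p i) (FractionQuotient R) := fun i m =>
    ⟨1, fun c hc => hfp i c (by simpa using hc) m⟩
  have hker : ∀ i j, i ≠ j → ∃ u ∉ p i, u • x j = 0 := by
    intro i j hij
    obtain ⟨l, hl⟩ := hx j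
    have hle : ¬ p j ^ l ≤ p i := fun hle =>
      hij (hpinj ((hp j).eq_of_le (hp i).ne_top ((hp i).isPrime.le_of_pow_le hle)).symm)
    obtain ⟨u, hu, hup⟩ := Set.not_subset.1 hle
    exact ⟨u, hup, hl u hu⟩
  have hfx0 : ∀ i j, i ≠ j → f i (x j) = 0 := by
    intro i j hij
    obtain ⟨u, hu, hux⟩ := hker i j hij
    exact eq_zero_of_mem_primaryPart (hp i) (hfprim i _) hu (by rw [← map_smul, hux, map_zero])
  let c : ℕ → M := fun n => ∑ i ∈ Finset.range n, x i
  have hc : ∀ n, c (n + 1) = c n + x n := fun n => Finset.sum_range_succ _ _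
  obtain ⟨n, hn⟩ := hM.exists_sup_span_singleton_eq_top (⨅ i, LinearMap.ker (f i)) c
    (fun n => by
      obtain ⟨u, hu, huc⟩ := exists_notMem_smul_sum_eq_zero (hp n).isPrime x (Finset.range n)
        fun i hi => hker n i (Finset.mem_range.1 hi).ne'
      obtain ⟨l, hl⟩ := hx n
      obtain ⟨w, hw⟩ := exists_one_sub_mul_mem_pow (hp n) hu l
      refine mem_span_singleton.2 ⟨1 - w * u, ?_⟩
      rw [hc, smul_add, hl _ hw, add_zero, sub_smul, mul_smul, one_smul, huc, smul_zero, sub_zero])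
    (by
      rw [eq_top_iff]
      rintro m -
      obtain ⟨a, ha0, ham⟩ := hT m
      have hfin : {i | a ∈ p i}.Finite := by
        have h1 := Ideal.finite_factors (I := Ideal.span {a}) (by simpa using ha0)
        refine Set.Finite.of_finite_image (f := fun i => (v i).1) (h1.subset ?_) fun i _ j _ h =>
          v.injective (Subtype.ext h)
        rintro _ ⟨i, hi, rfl⟩
        exact Ideal.dvd_span_singleton.2 hi
      choose r hr using fun i => mem_span_singleton.1 (hspan i m)
      rw [← sub_add_cancel m (∑ i ∈ hfin.toFinset, r i • x i)]
      refine add_mem (mem_sup_left ?_) (mem_sup_right (sum_mem fun i _ => smul_mem _ _ ?_))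
      · rw [mem_iInf]
        intro j
        rw [LinearMap.mem_ker, map_sub, map_sum, sub_eq_zero]
        by_cases hj : a ∈ p j
        · rw [Finset.sum_eq_single_of_mem j (by simpa using hj), map_smul, hr]
          intro i _ hij
          rw [map_smul, hfx0 j i hij.symm, smul_zero]
        · rw [Finset.sum_eq_zero, eq_zero_of_mem_primaryPart (hp j) (hfprim j m) hj
            (by rw [← map_smul, ham, map_zero])]
          intro i hi
          have hij : j ≠ i := by
            rintro rfl
            exact hj (by simpa using hi)
          rw [map_smul, hfx0 j i hij, smul_zero]
      · rw [← add_sub_cancel_left (c i) (x i), ← hc]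
        exact sub_mem (subset_span ⟨_, rfl⟩) (subset_span ⟨_, rfl⟩))
  obtain ⟨y, hy, z, hz, hyz⟩ := mem_sup.1 (hn.ge (mem_top (x := x n)))
  obtain ⟨r, rfl⟩ := mem_span_singleton.1 hz
  refine hfx n ?_
  have hy0 : f n y = 0 := (mem_iInf _).1 hy n
  have hc0 : f n (c n) = 0 := by
    rw [map_sum]
    exact Finset.sum_eq_zero fun i hi => hfx0 n i (Finset.mem_range.1 hi).ne'
  rw [← hyz, map_add, map_smul, hy0, hc0, smul_zero, add_zero]

/-- A regularly weakly based torsion module is bounded. -/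
theorem RegularlyWeaklyBased.exists_smul_eq_zero_of_torsion {R M : Type*} [CommRing R]
    [IsDedekindDomain R] (hR : ¬ IsField R) [AddCommGroup M] [Module R M]
    (hM : RegularlyWeaklyBased R M) (hT : ∀ x : M, ∃ a : R, a ≠ 0 ∧ a • x = 0) :
    ∃ r : R, r ≠ 0 ∧ ∀ x : M, r • x = 0 := by
  have hfin := hM.finite_primaryPart_ne_bot hR hT
  choose s hs hs0 using fun v : HeightOneSpectrum R =>
    Submodule.exists_mem_ne_zero_of_ne_bot v.ne_bot
  choose n hn using fun v : HeightOneSpectrum R =>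
    hM.exists_pow_smul_primaryPart_eq_zero hR v.isMaximal (hs v)
  refine ⟨∏ v ∈ hfin.toFinset, s v ^ n v,
    Finset.prod_ne_zero_iff.2 fun v _ => pow_ne_zero _ (hs0 v), fun m => ?_⟩
  set r := ∏ v ∈ hfin.toFinset, s v ^ n v
  -- Checked locally: for every maximal `p`, some `β ∉ p` annihilates `r • m`.
  suffices h : Ideal.torsionOf R M (r • m) = ⊤ by
    have : (1 : R) ∈ Ideal.torsionOf R M (r • m) := h ▸ trivial
    rwa [Ideal.mem_torsionOf_iff, one_smul] at this
  by_contra hne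
  obtain ⟨p, hp, hle⟩ := Ideal.exists_le_maximal _ hne
  let v : HeightOneSpectrum R :=
    ⟨p, hp.isPrime, Ring.ne_bot_of_isMaximal_of_not_isField hp hR⟩
  obtain ⟨a, ha0, ham⟩ := hT m
  obtain ⟨β, hβ, hβm⟩ := exists_smul_mem_primaryPart hp ha0 ham
  refine hβ (hle ((Ideal.mem_torsionOf_iff _ _).2 ?_))
  rw [smul_comm]
  by_cases hv : primaryPart v.asIdeal M = ⊥
  · have : β • m = 0 := by
      have h := hβm
      rwa [show primaryPart p M = ⊥ from hv] at h
    rw [this, smul_zero]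
  · obtain ⟨t, ht⟩ : s v ^ n v ∣ r := Finset.dvd_prod_of_mem _ (by simpa using hv)
    rw [ht, mul_comm, mul_smul, hn v _ hβm, smul_zero]

/-! ### The splitting -/

theorem theorem4p5 {R : Type*} [CommRing R] [IsDedekindDomain R] (hR : ¬ IsField R)
    {M : Type*} [AddCommGroup M] [Module R M] (hM : RegularlyWeaklyBased R M) :
    ∃ P B : Submodule R M, IsCompl P B ∧
      (Module.Finite R P ∧ Module.Projective R P) ∧
      (Module.IsTorsion R B ∧ IsBoundedModule R B) := by
  obtain ⟨I, hI, hImax⟩ := exists_maximal_linearIndepOn R (id : M → M)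
  have hIfin : I.Finite := by
    by_contra hinf
    exact hM.not_linearIndependent_nat hR _
      (LinearIndependent.comp hI _ (Set.Infinite.natEmbedding I hinf).injective)
  rw [Set.image_id] at hImax
  have hfree : Module.Free R (span R I) := by
    have := Module.Free.of_basis (Module.Basis.span hI)
    rwa [show Set.range (fun x : I => id (x : M)) = I by simp] at this
  have hfg : Module.Finite R (span R I) := Module.Finite.span_of_finite R hIfin
  obtain ⟨r, hr0, hr⟩ :=
    (hM.quotient_of_fg (fg_span hIfin)).exists_smul_eq_zero_of_torsion hR fun x => by
      obtain ⟨m, rfl⟩ := Submodule.mkQ_surjective _ x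
      by_cases hm : m ∈ I
      · exact ⟨1, one_ne_zero, by
          rw [one_smul]; exact (Submodule.Quotient.mk_eq_zero _).2 (subset_span hm)⟩
      · obtain ⟨a, ha, ham⟩ := hImax m hm
        exact ⟨a, ha, (Submodule.Quotient.mk_eq_zero _).2 ham⟩
  -- Multiplication by `r` lands in a finite free module, so its range is finite and torsion-free,
  -- hence projective; a section `ψ` supplies `P`, and the kernel is `B`.
  let φ : M →ₗ[R] span R I := (LinearMap.lsmul R M r).codRestrict _ fun m =>
    (Submodule.Quotient.mk_eq_zero _).1 (hr (Submodule.Quotient.mk m))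
  have hproj : Module.Projective R (LinearMap.range φ) :=
    have := Module.finitePresentation_of_finite R (LinearMap.range φ)
    Module.Flat.projective_of_finitePresentation
  obtain ⟨ψ, hψ⟩ := Module.projective_lifting_property φ.rangeRestrict LinearMap.id
    φ.surjective_rangeRestrict
  have hψinj : Function.Injective ψ := LinearMap.injective_of_comp_eq_id _ _ hψ
  let e := LinearEquiv.ofInjective ψ hψinj
  have hker : ∀ x ∈ LinearMap.ker φ, r • x = 0 := fun x hx => congrArg Subtype.val hx
  refine ⟨LinearMap.range ψ, LinearMap.ker φ, ?_, ⟨Module.Finite.equiv e, .of_equiv e⟩, ?_, ?_⟩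
  · have := LinearMap.isCompl_of_proj (p := LinearMap.range ψ)
      (f := ψ.rangeRestrict ∘ₗ φ.rangeRestrict) (by
        rintro ⟨_, y, rfl⟩
        exact Subtype.ext (congrArg ψ (LinearMap.congr_fun hψ y)))
    rwa [LinearMap.ker_comp_of_ker_eq_bot _ (by simpa [LinearMap.ker_eq_bot] using hψinj),
      LinearMap.ker_rangeRestrict] at this
  · intro x
    exact ⟨⟨r, mem_nonZeroDivisors_of_ne_zero hr0⟩, Subtype.ext (hker x x.2)⟩
  · refine ⟨Ideal.span {r}, by simpa using hr0, ?_⟩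
    rw [eq_bot_iff, smul_le]
    intro a ha x _
    obtain ⟨t, rfl⟩ := Ideal.mem_span_singleton'.1 ha
    rw [mem_bot, mul_smul]
    exact Subtype.ext (by simp [hker x x.2])
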